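/- Definitions. An XOR game with prior distribution, $\mathcal G=(I,f,\pi)$, consists of a finite set $I$ of questions, a function $f:I\times I\to\mathbb Z_2$ and a probability distribution $\pi$ on $I\times I$; on questions $(x,y)$ the players win with answers $(a,b)\in\mathbb Z_2\times\mathbb Z_2$ if and only if $a+b=f(x,y)$. It is a *synchronous XOR game* if $f(x,x)=0$, $f(x,y)=f(y,x)$ and $\pi(x,y)=\pi(y,x)$ for all $x,y\in I$. A *quantum density* is a family $p(a,b|x,y)=\langle (E_{x,a}\otimes F_{y,b})\psi,\psi\rangle$, where $\{E_{x,a}\}_a$ and $\{F_{y,b}\}_b$ $(x,y\in I)$ are projection valued measures on finite dimensional complex Hilbert spaces $H_A$ and $H_B$, and $\psi\in H_A\otimes H_B$ is a unit vector; it is *synchronous* if $p(a,b|x,x)=0$ whenever $a\neq b$. The *synchronous quantum value* of $\mathcal G$ is $$\omega^s_q(\mathcal G)=\sup_p\ \sum_{x,y}\ \sum_{a+b=f(x,y)}\pi(x,y)\,p(a,b|x,y),$$ the supremum over all synchronous quantum densities $p$, and its *synchronous quantum bias* is $\epsilon^s_q(\mathcal G)=2\,\omega^s_q(\mathcal G)-1$.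 Let $A$ be the symmetrized cost matrix, $A=\tfrac12(C+C^T)$ with $C=\big((-1)^{f(x,y)}\pi(x,y)\big)_{x,y\in I}$. A synchronous XOR game $\mathcal G$ is *balanced* if the unique optimal solution $y^*\in\mathbb R^I$ of the dual semidefinite program $$\text{minimize } \sum_{k\in I} y_k\quad\text{subject to}\quad \mathrm{Diag}(y)-A\succeq 0$$ satisfies $-\mathrm{Diag}(y^*)\preceq A\preceq \mathrm{Diag}(y^*)$, where $\preceq$ is the positive semidefinite order. The XOR $\mathcal G_1\oplus\mathcal G_2$ of $\mathcal G_i=(I_i,f_i,\pi_i)$, $i=1,2$, is the XOR game with question set $I_1\times I_2$, function $f((x_1,x_2),(y_1,y_2))=f_1(x_1,y_1)+f_2(x_2,y_2)$ and distribution $\pi((x_1,x_2),(y_1,y_2))=\pi_1(x_1,y_1)\,\pi_2(x_2,y_2)$. Theorem. If $\mathcal G_1$ and $\mathcal G_2$ are balanced synchronous XOR games, then $$\epsilon^s_q(\mathcal G_1\oplus\mathcal G_2)=\epsilon^s_q(\mathcal G_1)\,\epsilon^s_q(\mathcal G_2),$$ and $\mathcal G_1\oplus\mathcal G_2$ is again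 a balanced synchronous XOR game. -/

import Mathlib

namespace XORGames

open Matrix
open scoped Kronecker

universe u v

/-- A two-player nonlocal game in which both players have the question set `I` and the answer
set `O`: a verification function `rule` (`true` means that the players win on questions `x, y`
and answers `a, b`), together with a prior probability distribution on pairs of questions. -/
structure Game (I : Type u) (O : Type v) [Fintype I] where
  rule : I → I → O → O → Bool
  prior : I → I → ℝ
  prior_nonneg : ∀ x y, 0 ≤ prior x y
  prior_sum : ∑ x, ∑ y, prior x y = 1

/-- The projection valued measures with outcome set `O` in the `n × n` complex matrices. -/
def IsPVM {O : Type v} [Fintype O] {n : ℕ} (E : O → Matrix (Fin n) (Fin n) ℂ) : Prop :=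
  (∀ a, IsStarProjection (E a)) ∧ ∑ a, E a = 1

/-- The set `C_q` of quantum densities, where `p x y a b` stands for `p(a,b|x,y)`: those of the
form `p(a,b|x,y) = ⟨(E_{x,a} ⊗ F_{y,b}) ψ, ψ⟩` for projection valued measures `E_x`, `F_y` on
finite dimensional Hilbert spaces `ℂ^m`, `ℂ^n` and a unit vector `ψ` in `ℂ^m ⊗ ℂ^n`. -/
def quantumDensities (I : Type u) (O : Type v) [Fintype O] : Set (I → I → O → O → ℝ) :=
  {p | ∃ (m n : ℕ) (E : I → O → Matrix (Fin m) (Fin m) ℂ) (F : I → O → Matrix (Fin n) (Fin n) ℂ)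
      (ψ : Fin m × Fin n → ℂ),
      (∀ x, IsPVM (E x)) ∧ (∀ y, IsPVM (F y)) ∧ star ψ ⬝ᵥ ψ = 1 ∧
      ∀ x y a b, (p x y a b : ℂ) = star ψ ⬝ᵥ ((E x a ⊗ₖ F y b) *ᵥ ψ)}

/-- The set `C_q^s` of synchronous quantum densities. -/
def syncQuantumDensities (I : Type u) (O : Type v) [Fintype O] : Set (I → I → O → O → ℝ) :=
  {p | p ∈ quantumDensities I O ∧ ∀ x a b, a ≠ b → p x x a b = 0}

namespace Game

variable {I : Type u} {O : Type v} [Fintype I]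

/-- The probability of winning when the players answer according to the density `p`. -/
noncomputable def value [Fintype O] (G : Game I O) (p : I → I → O → O → ℝ) : ℝ :=
  ∑ x, ∑ y, ∑ a, ∑ b, G.prior x y * (if G.rule x y a b = true then 1 else 0) * p x y a b

/-- The synchronous quantum value `ω^s_q`. -/
noncomputable def syncQuantumValue [Fintype O] (G : Game I O) : ℝ :=
  sSup (G.value '' syncQuantumDensities I O)

/-- The synchronous quantum bias `ε^s_q = 2 ω^s_q - 1`. -/
noncomputable def syncQuantumBias [Fintype O] (G : Game I O) : ℝ :=
  2 * G.syncQuantumValue - 1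

/-- On equal questions, different answers lose. -/
def IsSynchronous (G : Game I O) : Prop :=
  ∀ x a b, a ≠ b → G.rule x x a b = false

/-- Interchanging the two players does not change the rules. -/
def IsSymmetric (G : Game I O) : Prop :=
  ∀ x y a b, G.rule x y a b = G.rule y x b a

end Game

/-- An XOR game with a prior distribution: the answers are bits, and on questions `x, y` the
answers `a, b` win if and only if `a + b = f x y` in `ZMod 2`. -/
structure XORGame (I : Type u) [Fintype I] where
  f : I → I → ZMod 2
  prior : I → I → ℝ
  prior_nonneg : ∀ x y, 0 ≤ prior x y
  prior_sum : ∑ x, ∑ y, prior x y = 1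

/-- `y` is feasible for the semidefinite program
`minimize ∑ y_k subject to Diag(y) - A ⪰ 0`. -/
def IsDualFeasible {I : Type u} [DecidableEq I] (A : Matrix I I ℝ) (y : I → ℝ) : Prop :=
  (diagonal y - A).PosSemidef

/-- `y` is an optimal solution of the semidefinite program
`minimize ∑ y_k subject to Diag(y) - A ⪰ 0`. -/
def IsDualOptimal {I : Type u} [Fintype I] [DecidableEq I] (A : Matrix I I ℝ) (y : I → ℝ) :
    Prop :=
  IsDualFeasible A y ∧ ∀ z, IsDualFeasible A z → ∑ k, y k ≤ ∑ k, z k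

namespace XORGame

variable {I : Type u} [Fintype I]

/-- The nonlocal game given by an XOR game. -/
def toGame (G : XORGame I) : Game I (ZMod 2) where
  rule x y a b := decide (a + b = G.f x y)
  prior := G.prior
  prior_nonneg := G.prior_nonneg
  prior_sum := G.prior_sum

/-- A synchronous XOR game: the game is synchronous and symmetric, and so is its prior
distribution. -/
def IsSyncXOR (G : XORGame I) : Prop :=
  G.toGame.IsSynchronous ∧ G.toGame.IsSymmetric ∧ ∀ x y, G.prior x y = G.prior y x

/-- The cost matrix `((-1)^{f(x,y)} π(x,y))`. -/
noncomputable def costMatrix (G : XORGame I) : Matrix I I ℝ :=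
  Matrix.of fun x y => (-1 : ℝ) ^ (G.f x y).val * G.prior x y

/-- The symmetrized cost matrix `(A + Aᵀ) / 2`, where `A` is the cost matrix. -/
noncomputable def symCostMatrix (G : XORGame I) : Matrix I I ℝ :=
  (1 / 2 : ℝ) • (G.costMatrix + G.costMatrixᵀ)

/-- A balanced game: a synchronous XOR game whose dual semidefinite program has a unique optimal
solution `y`, with `-Diag(y) ≤ A ≤ Diag(y)` for the symmetrized cost matrix `A`. -/
def IsBalanced [DecidableEq I] (G : XORGame I) : Prop :=
  G.IsSyncXOR ∧
    ∃ y : I → ℝ, (∀ z, IsDualOptimal G.symCostMatrix z ↔ z = y) ∧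
      (diagonal y - G.symCostMatrix).PosSemidef ∧ (G.symCostMatrix - -diagonal y).PosSemidef

/-- The XOR `G₁ ⊕ G₂` of two XOR games, with the product distribution. -/
def xor {J : Type v} [Fintype J] (G₁ : XORGame I) (G₂ : XORGame J) : XORGame (I × J) where
  f x y := G₁.f x.1 y.1 + G₂.f x.2 y.2
  prior x y := G₁.prior x.1 y.1 * G₂.prior x.2 y.2
  prior_nonneg x y := mul_nonneg (G₁.prior_nonneg _ _) (G₂.prior_nonneg _ _)
  prior_sum := by
    have h : ∀ x : I × J, ∑ y : I × J, G₁.prior x.1 y.1 * G₂.prior x.2 y.2 =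
        (∑ i, G₁.prior x.1 i) * ∑ j, G₂.prior x.2 j := fun x => by
      rw [Fintype.sum_prod_type, Finset.sum_mul_sum]
    simp_rw [h, Fintype.sum_prod_type]
    simp only [← Finset.sum_mul_sum, G₁.prior_sum, G₂.prior_sum, one_mul]

end XORGame

end XORGames

namespace XORGames

open Matrix
open scoped Kronecker

/-! For a synchronous density, perfect agreement on equal questions makes the correlator a real Gram
matrix of unit vectors. Conversely, Clifford generators realize every such matrix
(`isCorrelation_correlator`, `exists_mem_syncQuantumDensities_correlator_eq`). So the bias is the
maximum of `tr(A X)` over correlation matrices, a semidefinite program.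

Its dual has no gap: at a maximizer `X`, second-order optimality makes `diag(A X)` dual feasible.
Complementary slackness identifies every dual optimum with `diag(A X)`, so it is unique.

For the XOR the cost matrix is `A₁ ⊗ A₂`. The products `X₁ ⊗ X₂` and `y₁ ⊗ y₂` have equal objective
values, hence are both optimal once `y₁ ⊗ y₂` is feasible. That is what balance supplies
(`posSemidef_kronecker_sub_kronecker`), together with balance of the product. -/

/-- A correlation matrix: a positive semidefinite matrix with unit diagonal. -/
def IsCorrelation {I : Type*} (X : Matrix I I ℝ) : Prop :=
  X.PosSemidef ∧ ∀ i, X i i = 1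

theorem isCorrelation_one {I : Type*} [DecidableEq I] : IsCorrelation (1 : Matrix I I ℝ) :=
  ⟨PosSemidef.one, fun i => one_apply_eq i⟩

theorem IsCorrelation.apply_symm {I : Type*} {X : Matrix I I ℝ} (hX : IsCorrelation X) (i j : I) :
    X i j = X j i := by
  simpa using hX.1.1.apply j i

/-- One-sided because the perturbation below exists only for `h ≥ 0`. -/
theorem nonpos_of_hasDerivAt_of_eventually_le {g : ℝ → ℝ} {g' x : ℝ} (hg : HasDerivAt g g' x)
    (h : ∀ᶠ t in nhdsWithin x (Set.Ioi x), g t ≤ g x) : g' ≤ 0 := by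
  have hsub : Set.Ioi x ⊆ {x}ᶜ := fun t ht => (Set.mem_Ioi.mp ht).ne'
  have ht := (hasDerivAt_iff_tendsto_slope.mp hg).mono_left (nhdsWithin_mono x hsub)
  refine le_of_tendsto ht ?_
  filter_upwards [h, self_mem_nhdsWithin] with t h1 h2
  rw [slope_def_field]
  exact div_nonpos_of_nonpos_of_nonneg (by linarith) (by linarith [Set.mem_Ioi.mp h2])

/-! ### Semidefinite duality over correlation matrices -/

section Duality

variable {I : Type*} [Fintype I]

theorem trace_mul_vecMulVec_star (M : Matrix I I ℝ) (v : I → ℝ) :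
    (M * vecMulVec v (star v)).trace = star v ⬝ᵥ (M *ᵥ v) := by
  rw [mul_vecMulVec, trace_vecMulVec, dotProduct_comm]

theorem trace_mul_nonneg {M X : Matrix I I ℝ} (hM : M.PosSemidef) (hX : X.PosSemidef) :
    0 ≤ (M * X).trace := by
  obtain ⟨m, v, rfl⟩ := posSemidef_iff_eq_sum_vecMulVec.mp hX
  rw [Finset.mul_sum, trace_sum]
  refine Finset.sum_nonneg fun k _ => ?_
  rw [trace_mul_vecMulVec_star]
  exact hM.dotProduct_mulVec_nonneg _

/-- Complementary slackness: with `X = ∑ v vᵀ`, the trace is a sum of nonnegative terms `vᵀ M v`, so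
each vanishes and `M v = 0`. -/
theorem mul_eq_zero_of_trace_mul_eq_zero {M X : Matrix I I ℝ} (hM : M.PosSemidef)
    (hX : X.PosSemidef) (h : (M * X).trace = 0) : M * X = 0 := by
  obtain ⟨m, v, rfl⟩ := posSemidef_iff_eq_sum_vecMulVec.mp hX
  rw [Finset.mul_sum, trace_sum] at h
  rw [Finset.mul_sum]
  have h0 : ∀ k ∈ Finset.univ, 0 ≤ (M * vecMulVec (v k) (star (v k))).trace := fun k _ => by
    rw [trace_mul_vecMulVec_star]
    exact hM.dotProduct_mulVec_nonneg _
  refine Finset.sum_eq_zero fun k hk => ?_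
  have hk0 := (Finset.sum_eq_zero_iff_of_nonneg h0).mp h k hk
  rw [trace_mul_vecMulVec_star, hM.dotProduct_mulVec_zero_iff] at hk0
  rw [mul_vecMulVec, hk0, zero_vecMulVec]

variable [DecidableEq I]

theorem trace_diagonal_mul_of_diag_eq_one {X : Matrix I I ℝ} (hX : ∀ i, X i i = 1) (y : I → ℝ) :
    (diagonal y * X).trace = ∑ i, y i := by
  simp [trace, diagonal_mul, hX]

theorem trace_mul_le_of_isDualFeasible {A X : Matrix I I ℝ} {y : I → ℝ} (hX : IsCorrelation X)
    (hy : IsDualFeasible A y) : (A * X).trace ≤ ∑ i, y i := by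
  have h := trace_mul_nonneg hy hX.1
  rw [sub_mul, trace_sub, trace_diagonal_mul_of_diag_eq_one hX.2] at h
  linarith

theorem isDualOptimal_of_trace_eq {A X : Matrix I I ℝ} {y : I → ℝ} (hX : IsCorrelation X)
    (hy : IsDualFeasible A y) (h : (A * X).trace = ∑ i, y i) : IsDualOptimal A y :=
  ⟨hy, fun _ hz => h ▸ trace_mul_le_of_isDualFeasible hX hz⟩

/-- The diagonal of `(Diag y - A) X = 0` determines `y`, since `X` has unit diagonal. -/
theorem eq_diag_of_trace_eq {A X : Matrix I I ℝ} {y : I → ℝ} (hX : IsCorrelation X)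
    (hy : IsDualFeasible A y) (h : (A * X).trace = ∑ i, y i) : y = (A * X).diag := by
  have h0 : ((diagonal y - A) * X).trace = 0 := by
    rw [sub_mul, trace_sub, trace_diagonal_mul_of_diag_eq_one hX.2, h, sub_self]
  have h1 := mul_eq_zero_of_trace_mul_eq_zero hy hX.1 h0
  ext i
  have h2 := congrFun (congrFun h1 i) i
  rw [sub_mul, Matrix.sub_apply, diagonal_mul, hX.2 i] at h2
  simp only [Matrix.zero_apply] at h2
  rw [diag_apply]
  linarith

theorem isDualOptimal_iff_eq_of_trace_eq {A X : Matrix I I ℝ} {y : I → ℝ} (hX : IsCorrelation X)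
    (hy : IsDualFeasible A y) (h : (A * X).trace = ∑ i, y i) (z : I → ℝ) :
    IsDualOptimal A z ↔ z = y := by
  have hopt := isDualOptimal_of_trace_eq hX hy h
  refine ⟨fun hz => ?_, fun hz => hz ▸ hopt⟩
  have hzy : (A * X).trace = ∑ i, z i :=
    le_antisymm (trace_mul_le_of_isDualFeasible hX hz.1) (h ▸ hz.2 y hy)
  rw [eq_diag_of_trace_eq hX hz.1 hzy, eq_diag_of_trace_eq hX hy h]

theorem IsCorrelation.abs_apply_le_one {X : Matrix I I ℝ} (hX : IsCorrelation X) (i j : I) :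
    |X i j| ≤ 1 := by
  have key : ∀ s : ℝ, 0 ≤ 1 + 2 * s * X i j + s * s := fun s => by
    have h := hX.1.dotProduct_mulVec_nonneg (Pi.single i 1 + Pi.single j s)
    simp [mulVec_add, add_dotProduct, hX.2, hX.apply_symm j i] at h
    linarith
  have h1 := key 1
  have h2 := key (-1)
  exact abs_le.mpr ⟨by linarith, by linarith⟩

theorem isCompact_setOf_isCorrelation : IsCompact {X : Matrix I I ℝ | IsCorrelation X} := by
  have hsub : {X : Matrix I I ℝ | IsCorrelation X} ⊆
      Set.pi Set.univ fun _ => Set.pi Set.univ fun _ => Set.Icc (-1 : ℝ) 1 :=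
    fun X hX i _ j _ => abs_le.mp (hX.abs_apply_le_one i j)
  refine IsCompact.of_isClosed_subset
    (isCompact_univ_pi fun _ => isCompact_univ_pi fun _ => isCompact_Icc) ?_ hsub
  have heq : {X : Matrix I I ℝ | IsCorrelation X} =
      ({X | Xᴴ = X} ∩ ⋂ v : I → ℝ, {X | 0 ≤ star v ⬝ᵥ (X *ᵥ v)}) ∩ ⋂ i, {X | X i i = 1} := by
    ext X
    simp [IsCorrelation, posSemidef_iff_dotProduct_mulVec, IsHermitian]
  rw [heq]
  refine IsClosed.inter (IsClosed.inter ?_ (isClosed_iInter fun v => ?_))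
    (isClosed_iInter fun i => ?_)
  · exact isClosed_eq (by fun_prop) continuous_id
  · exact isClosed_le continuous_const (by fun_prop)
  · exact isClosed_eq (by fun_prop) continuous_const

theorem exists_isCorrelation_forall_trace_mul_le (A : Matrix I I ℝ) :
    ∃ X, IsCorrelation X ∧ ∀ Y, IsCorrelation Y → (A * Y).trace ≤ (A * X).trace := by
  obtain ⟨X, hX, hmax⟩ := isCompact_setOf_isCorrelation.exists_isMaxOn
    (s := {X : Matrix I I ℝ | IsCorrelation X}) (f := fun X => (A * X).trace)
    ⟨1, isCorrelation_one⟩ (by fun_prop)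
  exact ⟨X, hX, fun Y hY => hmax hY⟩

/-- The correlation matrix of the vectors obtained by rotating the vectors of `X` towards an
orthogonal direction, the `i`-th one by the angle with sine `√h * w i`. -/
theorem IsCorrelation.perturb {X : Matrix I I ℝ} (hX : IsCorrelation X) (w : I → ℝ) {h : ℝ}
    (h0 : 0 ≤ h) (h1 : ∀ i, h * w i ^ 2 ≤ 1) :
    IsCorrelation (of fun i j => √(1 - h * w i ^ 2) * √(1 - h * w j ^ 2) * X i j +
      h * (w i * w j)) := by
  constructor
  · have hp := (hX.1.conjTranspose_mul_mul_same
      (diagonal fun i => √(1 - h * w i ^ 2))).add ((posSemidef_vecMulVec_self_star w).smul h0)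
    convert hp using 1
    ext i j
    simp [diagonal_mul, mul_diagonal, vecMulVec_apply]
    ring
  · intro i
    simp only [of_apply, hX.2 i]
    rw [Real.mul_self_sqrt (by linarith [h1 i])]
    ring

/-- Differentiate `tr(A Y)` at `h = 0⁺` along `IsCorrelation.perturb`. As `h` is quadratic in the
rotation angles, this first derivative carries the second-order condition. -/
theorem dotProduct_mulVec_le_of_maximal {A X : Matrix I I ℝ} (hA : A.IsHermitian)
    (hX : IsCorrelation X) (hmax : ∀ Y, IsCorrelation Y → (A * Y).trace ≤ (A * X).trace)
    (w : I → ℝ) : w ⬝ᵥ (A *ᵥ w) ≤ ∑ i, (A * X).diag i * w i ^ 2 := by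
  have htr : ∀ Y : Matrix I I ℝ, (A * Y).trace = ∑ i, ∑ j, A i j * Y j i := fun Y => by
    simp [trace, mul_apply]
  have hder : HasDerivAt (fun h : ℝ => ∑ i, ∑ j, A i j *
      (√(1 - h * w j ^ 2) * √(1 - h * w i ^ 2) * X j i + h * (w j * w i)))
      (∑ i, ∑ j, A i j * ((-(w j ^ 2 / 2) - w i ^ 2 / 2) * X j i + w j * w i)) 0 := by
    have hs : ∀ i, HasDerivAt (fun h : ℝ => √(1 - h * w i ^ 2)) (-(w i ^ 2 / 2)) 0 := fun i => by
      have h := (((hasDerivAt_id (0 : ℝ)).mul_const (w i ^ 2)).const_sub 1).sqrt (by simp)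
      refine h.congr_deriv ?_
      simp
      ring
    refine HasDerivAt.fun_sum fun i _ => HasDerivAt.fun_sum fun j _ => ?_
    have h := ((((hs j).mul (hs i)).mul_const (X j i)).add
      ((hasDerivAt_id (0 : ℝ)).mul_const (w j * w i))).const_mul (A i j)
    refine h.congr_deriv ?_
    simp only [zero_mul, sub_zero, Real.sqrt_one]
    ring
  have hle := nonpos_of_hasDerivAt_of_eventually_le hder ?_
  · have h1 : ∑ i, ∑ j, A i j * (w j ^ 2 * X j i) = ∑ i, ∑ j, A i j * (w i ^ 2 * X j i) := by
      rw [Finset.sum_comm]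
      refine Finset.sum_congr rfl fun i _ => Finset.sum_congr rfl fun j _ => ?_
      rw [hX.apply_symm i j, show A j i = A i j by simpa using hA.apply i j]
    have h2 : ∑ i, (A * X).diag i * w i ^ 2 = ∑ i, ∑ j, A i j * (w i ^ 2 * X j i) := by
      simp only [diag_apply, mul_apply, Finset.sum_mul]
      exact Finset.sum_congr rfl fun i _ => Finset.sum_congr rfl fun j _ => by ring
    have h3 : w ⬝ᵥ (A *ᵥ w) = ∑ i, ∑ j, A i j * (w j * w i) := by
      simp only [dotProduct, mulVec, Finset.mul_sum]
      exact Finset.sum_congr rfl fun i _ => Finset.sum_congr rfl fun j _ => by ring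
    have h4 : ∑ i, ∑ j, A i j * ((-(w j ^ 2 / 2) - w i ^ 2 / 2) * X j i + w j * w i) =
        ∑ i, ∑ j, A i j * (w j * w i) - (1 / 2) * ∑ i, ∑ j, A i j * (w j ^ 2 * X j i) -
          (1 / 2) * ∑ i, ∑ j, A i j * (w i ^ 2 * X j i) := by
      simp only [Finset.mul_sum, ← Finset.sum_sub_distrib]
      exact Finset.sum_congr rfl fun i _ => Finset.sum_congr rfl fun j _ => by ring
    rw [h4, h1] at hle
    rw [h2, h3]
    linarith
  · have hsmall : ∀ᶠ h : ℝ in nhds 0, ∀ i, h * w i ^ 2 < 1 := by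
      refine Filter.eventually_all.mpr fun i => ?_
      have hc : Continuous fun h : ℝ => h * w i ^ 2 := by fun_prop
      exact hc.continuousAt.eventually_lt continuousAt_const (by simp)
    filter_upwards [hsmall.filter_mono nhdsWithin_le_nhds, self_mem_nhdsWithin] with h h1 h2
    have h3 := hmax _ (hX.perturb w (le_of_lt h2) fun i => (h1 i).le)
    rw [htr, htr] at h3
    simpa using h3

/-- Strong duality for the semidefinite program over correlation matrices: the second-order
optimality condition at a maximizer `X` makes the diagonal of `A * X` dual feasible. -/
theorem exists_isCorrelation_isDualFeasible_diag {A : Matrix I I ℝ} (hA : A.IsHermitian) :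
    ∃ X, IsCorrelation X ∧ IsDualFeasible A (A * X).diag := by
  obtain ⟨X, hX, hmax⟩ := exists_isCorrelation_forall_trace_mul_le A
  refine ⟨X, hX, PosSemidef.of_dotProduct_mulVec_nonneg ((isHermitian_diagonal _).sub hA) ?_⟩
  intro w
  have h := dotProduct_mulVec_le_of_maximal hA hX hmax w
  rw [sub_mulVec, dotProduct_sub, sub_nonneg]
  refine h.trans_eq ?_
  simp only [dotProduct, mulVec_diagonal, star_trivial]
  exact Finset.sum_congr rfl fun i _ => by ring

theorem IsDualOptimal.exists_isCorrelation_trace_eq {A : Matrix I I ℝ} (hA : A.IsHermitian)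
    {y : I → ℝ} (hy : IsDualOptimal A y) : ∃ X, IsCorrelation X ∧ (A * X).trace = ∑ i, y i := by
  obtain ⟨X, hX, hf⟩ := exists_isCorrelation_isDualFeasible_diag hA
  exact ⟨X, hX, le_antisymm (trace_mul_le_of_isDualFeasible hX hy.1) (hy.2 _ hf)⟩

end Duality

end XORGames

namespace XORGames

open Matrix
open scoped Kronecker ComplexOrder

/-! ### Clifford generators and anticommuting involutions -/

section Clifford

/-- Hermitian matrices that satisfy the relations of the Clifford algebra on `N` generators. -/
theorem exists_clifford_generators (N : ℕ) :
    ∃ (κ : Type) (_ : Fintype κ) (_ : DecidableEq κ) (_ : Nonempty κ) (γ : Fin N → Matrix κ κ ℂ),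
      (∀ k, (γ k).IsHermitian) ∧
      ∀ k l, γ k * γ l + γ l * γ k = if k = l then 2 else 0 := by
  induction N with
  | zero => exact ⟨Unit, inferInstance, inferInstance, inferInstance, fun _ => 0,
      fun k => k.elim0, fun k => k.elim0⟩
  | succ N ih =>
    obtain ⟨κ, _, _, _, γ, hγ, hrel⟩ := ih
    have h2 : (2 : Matrix (κ ⊕ κ) (κ ⊕ κ) ℂ) = fromBlocks 2 0 0 2 := by
      rw [← one_add_one_eq_two, ← fromBlocks_one, fromBlocks_add, one_add_one_eq_two, add_zero]
    refine ⟨κ ⊕ κ, inferInstance, inferInstance, inferInstance,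
      -- The grading `diag(1, -1)` anticommutes with every off-diagonal block matrix.
      Fin.cons (fromBlocks 1 0 0 (-1)) fun k => fromBlocks 0 (γ k) (γ k) 0, ?_, ?_⟩
    · refine Fin.cases ?_ fun k => ?_
      · simp [IsHermitian, fromBlocks_conjTranspose]
      · simp [IsHermitian, fromBlocks_conjTranspose, (hγ k).eq]
    · refine Fin.cases (Fin.cases ?_ fun l => ?_) fun k => Fin.cases ?_ fun l => ?_
      · simp [fromBlocks_multiply, h2, one_add_one_eq_two]
      · simp [fromBlocks_multiply, fromBlocks_add, (Fin.succ_ne_zero l).symm]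
      · simp [fromBlocks_multiply, fromBlocks_add, Fin.succ_ne_zero k]
      · simp only [Fin.cons_succ, fromBlocks_multiply, fromBlocks_add, Fin.succ_inj, h2]
        simp only [Matrix.mul_zero, Matrix.zero_mul, add_zero, zero_add, hrel]
        split_ifs <;> simp

/-- Write `X` as a Gram matrix and put `U x = ∑ v k x • γ k`. The Clifford relations give `U x U y +
U y U x = 2 X x y`: the diagonal yields involutions, the trace yields `X`. -/
theorem exists_hermitian_involutions {I : Type*} [Finite I] {X : Matrix I I ℝ}
    (hX : IsCorrelation X) :
    ∃ (m : ℕ) (U : I → Matrix (Fin m) (Fin m) ℂ), m ≠ 0 ∧ (∀ x, (U x).IsHermitian) ∧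
      (∀ x, U x * U x = 1) ∧ ∀ x y, (U x * U y).trace = m * X x y := by
  obtain ⟨N, v, hv⟩ := posSemidef_iff_eq_sum_vecMulVec.mp hX.1
  obtain ⟨κ, _, _, _, γ, hγ, hrel⟩ := exists_clifford_generators N
  have hXv : ∀ x y, X x y = ∑ k, v k x * v k y := fun x y => by
    rw [hv, Matrix.sum_apply]
    simp [vecMulVec_apply]
  let W : I → Matrix κ κ ℂ := fun x => ∑ k, (v k x : ℂ) • γ k
  have hW : ∀ x y, W x * W y + W y * W x = ((2 * X x y : ℝ) : ℂ) • 1 := fun x y => by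
    have h1 : W x * W y = ∑ k, ∑ l, ((v k x * v l y : ℝ) : ℂ) • (γ k * γ l) := by
      simp only [W, Finset.sum_mul_sum, smul_mul_smul_comm, Complex.ofReal_mul]
    have h2 : W y * W x = ∑ k, ∑ l, ((v k x * v l y : ℝ) : ℂ) • (γ l * γ k) := by
      rw [Finset.sum_comm]
      simp only [W, Finset.sum_mul_sum, smul_mul_smul_comm, Complex.ofReal_mul]
      simp only [mul_comm]
    rw [h1, h2, ← Finset.sum_add_distrib]
    simp only [← Finset.sum_add_distrib, ← smul_add, hrel, smul_ite, smul_zero,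
      Finset.sum_ite_eq, Finset.mem_univ, if_true]
    rw [← Finset.sum_smul, hXv, ← one_add_one_eq_two, smul_add, ← add_smul]
    push_cast
    rw [two_mul]
  have hWH : ∀ x, (W x).IsHermitian := fun x => by
    simp [W, IsHermitian, conjTranspose_sum, conjTranspose_smul, (hγ _).eq]
  let e := (Fintype.equivFin κ).symm
  refine ⟨Fintype.card κ, fun x => (W x).submatrix e e, Fintype.card_ne_zero,
    fun x => (hWH x).submatrix e, fun x => ?_, fun x y => ?_⟩
  · rw [submatrix_mul_equiv]
    have h := hW x x
    rw [hX.2, ← two_smul ℂ, mul_one, Complex.ofReal_ofNat] at h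
    rw [smul_right_injective _ (two_ne_zero' ℂ) h, submatrix_one_equiv]
  · have htr : ∀ M : Matrix κ κ ℂ, (M.submatrix e e).trace = M.trace := fun M =>
      Equiv.sum_comp e fun i => M i i
    rw [submatrix_mul_equiv, htr]
    have h := congrArg trace (hW x y)
    rw [trace_add, trace_mul_comm (W y), trace_smul, trace_one, smul_eq_mul] at h
    push_cast at h
    linear_combination h / 2

end Clifford

/-! ### Correlators of synchronous densities -/

section Densities

variable {I : Type*}

theorem sum_zmod_two {M : Type*} [AddCommMonoid M] (g : ZMod 2 → M) : ∑ a, g a = g 0 + g 1 :=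
  Fin.sum_univ_two g

/-- The matrix of correlations of the answers of the two players. -/
def correlator (p : I → I → ZMod 2 → ZMod 2 → ℝ) : Matrix I I ℝ :=
  of fun x y => p x y 0 0 - p x y 0 1 - (p x y 1 0 - p x y 1 1)

theorem isPVM_of_involution {m : ℕ} {U : Matrix (Fin m) (Fin m) ℂ} (hU : U.IsHermitian)
    (hU2 : U * U = 1) :
    IsPVM fun a : ZMod 2 => (1 / 2 : ℂ) • (1 + (if a = 0 then (1 : ℂ) else -1) • U) := by
  refine ⟨fun a => ⟨?_, ?_⟩, ?_⟩
  · rw [IsIdempotentElem]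
    beta_reduce
    split_ifs <;> simp [mul_add, add_mul, hU2] <;> module
  · rw [isSelfAdjoint_iff, star_eq_conjTranspose]
    beta_reduce
    split_ifs <;> simp [hU.eq]
  · rw [sum_zmod_two]
    simp
    module

/-- The density of the maximally entangled state on `ℂ^m ⊗ ℂ^m`. -/
theorem trace_density_mem {O : Type*} [Fintype O] {m : ℕ} (hm : m ≠ 0)
    {E : I → O → Matrix (Fin m) (Fin m) ℂ} (hE : ∀ x, IsPVM (E x))
    (p : I → I → O → O → ℝ) (hp : ∀ x y a b, (E x a * E y b).trace = m * p x y a b) :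
    p ∈ quantumDensities I O := by
  have hm' : (m : ℂ) ≠ 0 := by exact_mod_cast hm
  have hs : ((√(m : ℝ))⁻¹ : ℂ) * ((√(m : ℝ))⁻¹ : ℂ) * m = 1 := by
    rw [← mul_inv, ← Complex.ofReal_mul, Real.mul_self_sqrt (Nat.cast_nonneg m),
      Complex.ofReal_natCast, inv_mul_cancel₀ hm']
  -- Transposing the second player's projections turns the expectation in the maximally entangled
  -- state into `tr(E x a * E y b) / m`.
  refine ⟨m, m, E, fun x a => (E x a)ᵀ, vec (((√(m : ℝ))⁻¹ : ℂ) • 1), hE, fun y => ⟨fun a => ?_, ?_⟩,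
    ?_, fun x y a b => ?_⟩
  · obtain ⟨h1, h2⟩ := (hE y).1 a
    refine ⟨?_, ?_⟩
    · rw [IsIdempotentElem, ← transpose_mul, h1.eq]
    · rw [isSelfAdjoint_iff, star_eq_conjTranspose] at *
      exact congrArg transpose h2
  · rw [← transpose_sum, (hE y).2, transpose_one]
  · rw [star_vec_dotProduct_vec]
    simpa [mul_assoc] using hs
  · rw [kronecker_mulVec_vec, star_vec_dotProduct_vec]
    simp only [conjTranspose_smul, conjTranspose_one, Matrix.smul_mul, Matrix.one_mul,
      Matrix.mul_smul, Matrix.mul_one, trace_smul, smul_eq_mul, ← transpose_mul, trace_transpose,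
      hp]
    have h := congrArg (· * (p x y a b : ℂ)) hs
    simp only [star_inv₀, RCLike.star_def, Complex.conj_ofReal]
    linear_combination -h

theorem exists_mem_syncQuantumDensities_correlator_eq [Finite I] {X : Matrix I I ℝ}
    (hX : IsCorrelation X) : ∃ p ∈ syncQuantumDensities I (ZMod 2), correlator p = X := by
  obtain ⟨m, U, hm, hU, hU2, htr⟩ := exists_hermitian_involutions hX
  have hm' : (m : ℝ) ≠ 0 := by exact_mod_cast hm
  let s : ZMod 2 → ℝ := fun a => if a = 0 then 1 else -1
  let t : I → ℝ := fun x => (U x).trace.re / m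
  have ht : ∀ x, (U x).trace = m * t x := fun x => by
    have h : (starRingEnd ℂ) (U x).trace = (U x).trace := by
      rw [starRingEnd_apply, ← trace_conjTranspose, (hU x).eq]
    rw [← Complex.conj_eq_iff_re.mp h]
    simp only [t]
    push_cast
    rw [mul_div_cancel₀]
    exact_mod_cast hm
  -- This is `tr(E x a * E y b) / m` for the spectral projections `(1 + s a • U x) / 2`.
  let p : I → I → ZMod 2 → ZMod 2 → ℝ := fun x y a b =>
    (1 + s a * t x + s b * t y + s a * s b * X x y) / 4
  refine ⟨p, ⟨trace_density_mem hm (fun x => isPVM_of_involution (hU x) (hU2 x)) p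
    fun x y a b => ?_, fun x a b hab => ?_⟩, ?_⟩
  · simp only [Matrix.smul_mul, Matrix.mul_smul, mul_add, add_mul, trace_smul, trace_add, htr, ht,
      Matrix.mul_one, Matrix.one_mul, trace_one, Fintype.card_fin, smul_eq_mul, p, s]
    push_cast
    split_ifs <;> push_cast <;> ring
  · have h : s a + s b = 0 ∧ s a * s b = -1 := by
      have h01 : ∀ a b : ZMod 2, a ≠ b → (a = 0 ∧ b ≠ 0) ∨ (a ≠ 0 ∧ b = 0) := by decide
      rcases h01 a b hab with ⟨h1, h2⟩ | ⟨h1, h2⟩ <;> simp [s, h1, h2]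
    simp only [p, hX.2, h.2]
    linear_combination t x / 4 * h.1
  · ext x y
    simp [correlator, p, s]
    ring

theorem star_mulVec_dotProduct_mulVec {m n : Type*} [Fintype m] [Fintype n] (M N : Matrix m n ℂ)
    (ψ : n → ℂ) : star (M *ᵥ ψ) ⬝ᵥ (N *ᵥ ψ) = star ψ ⬝ᵥ ((Mᴴ * N) *ᵥ ψ) := by
  rw [star_mulVec, ← dotProduct_mulVec, mulVec_mulVec]

theorem IsPVM.sub_isHermitian {n : ℕ} {E : ZMod 2 → Matrix (Fin n) (Fin n) ℂ} (hE : IsPVM E) :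
    (E 0 - E 1).IsHermitian :=
  IsHermitian.sub (hE.1 0).2 (hE.1 1).2

theorem IsPVM.sub_mul_sub_self {n : ℕ} {E : ZMod 2 → Matrix (Fin n) (Fin n) ℂ} (hE : IsPVM E) :
    (E 0 - E 1) * (E 0 - E 1) = 1 := by
  have h := hE.2
  rw [sum_zmod_two, add_comm] at h
  rw [eq_sub_of_add_eq h]
  have h0 : E 0 * E 0 = E 0 := (hE.1 0).1
  simp only [sub_mul, mul_sub, h0, Matrix.one_mul, Matrix.mul_one]
  abel

theorem sum_eq_one_of_mem_quantumDensities {O : Type*} [Fintype O] {p : I → I → O → O → ℝ}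
    (hp : p ∈ quantumDensities I O) (x y : I) : ∑ a, ∑ b, p x y a b = 1 := by
  obtain ⟨m, n, E, F, ψ, hE, hF, hψ, h⟩ := hp
  have h1 : ∑ a, ∑ b, E x a ⊗ₖ F y b = (1 : Matrix (Fin m × Fin n) (Fin m × Fin n) ℂ) := by
    rw [← one_kronecker_one, ← (hE x).2, ← (hF y).2]
    ext i j
    simp [Matrix.sum_apply, Finset.sum_mul_sum]
  have h2 : ((∑ a, ∑ b, p x y a b : ℝ) : ℂ) = 1 := by
    push_cast
    simp only [h, ← dotProduct_sum, ← sum_mulVec]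
    rw [h1, one_mulVec, hψ]
  exact_mod_cast h2

/-- The two players' observables send `ψ` to unit vectors `α x`, `β y`. Synchronicity gives `⟨α x, β
x⟩ = 1`, so `‖β x - α x‖² = 0` and the correlator is the Gram matrix of `α`. -/
theorem isCorrelation_correlator [Finite I] {p : I → I → ZMod 2 → ZMod 2 → ℝ}
    (hp : p ∈ syncQuantumDensities I (ZMod 2)) : IsCorrelation (correlator p) := by
  have := Fintype.ofFinite I
  have hdiag : ∀ x, correlator p x x = 1 := fun x => by
    have h := sum_eq_one_of_mem_quantumDensities hp.1 x x
    simp only [sum_zmod_two, hp.2 x 0 1 zero_ne_one, hp.2 x 1 0 one_ne_zero] at h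
    simp only [correlator, of_apply, hp.2 x 0 1 zero_ne_one, hp.2 x 1 0 one_ne_zero]
    linarith
  refine ⟨?_, hdiag⟩
  obtain ⟨⟨m, n, E, F, ψ, hE, hF, hψ, h⟩, -⟩ := hp
  let α : I → Fin m × Fin n → ℂ := fun x => ((E x 0 - E x 1) ⊗ₖ 1) *ᵥ ψ
  let β : I → Fin m × Fin n → ℂ := fun y => (1 ⊗ₖ (F y 0 - F y 1)) *ᵥ ψ
  have hαβ : ∀ x y, star (α x) ⬝ᵥ β y = correlator p x y := fun x y => by
    rw [star_mulVec_dotProduct_mulVec, conjTranspose_kronecker, (hE x).sub_isHermitian.eq,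
      conjTranspose_one, ← mul_kronecker_mul, Matrix.one_mul, Matrix.mul_one]
    have hk : (E x 0 - E x 1) ⊗ₖ (F y 0 - F y 1) =
        E x 0 ⊗ₖ F y 0 - E x 0 ⊗ₖ F y 1 - (E x 1 ⊗ₖ F y 0 - E x 1 ⊗ₖ F y 1) := by
      ext i j
      simp
      ring
    simp only [correlator, of_apply, Complex.ofReal_sub, h, hk, sub_mulVec, dotProduct_sub]
  have hα : ∀ x, star (α x) ⬝ᵥ α x = 1 := fun x => by
    rw [star_mulVec_dotProduct_mulVec, conjTranspose_kronecker, (hE x).sub_isHermitian.eq,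
      conjTranspose_one, ← mul_kronecker_mul, Matrix.one_mul, (hE x).sub_mul_sub_self,
      one_kronecker_one, one_mulVec, hψ]
  have hβ : ∀ x, star (β x) ⬝ᵥ β x = 1 := fun x => by
    rw [star_mulVec_dotProduct_mulVec, conjTranspose_kronecker, (hF x).sub_isHermitian.eq,
      conjTranspose_one, ← mul_kronecker_mul, Matrix.one_mul, (hF x).sub_mul_sub_self,
      one_kronecker_one, one_mulVec, hψ]
  have heq : ∀ x, β x = α x := fun x => by
    have h1 : star (α x) ⬝ᵥ β x = 1 := by rw [hαβ, hdiag, Complex.ofReal_one]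
    have h2 : star (β x) ⬝ᵥ α x = 1 := by
      rw [star_dotProduct, h1, star_one]
    rw [← sub_eq_zero, ← dotProduct_star_self_eq_zero]
    simp only [star_sub, sub_dotProduct, dotProduct_sub, hα, hβ, h1, h2]
    ring
  have hgram : (correlator p).map ((↑) : ℝ → ℂ) = (of fun i x => α x i)ᴴ * of fun i x => α x i := by
    ext x y
    rw [map_apply, ← hαβ, heq]
    simp [mul_apply, dotProduct]
  have hpsd := posSemidef_conjTranspose_mul_self (of fun i x => α x i)
  rw [← hgram] at hpsd
  -- The Gram matrix is complex; its entries are real, so testing on real vectors suffices.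
  refine PosSemidef.of_dotProduct_mulVec_nonneg ?_ fun w => ?_
  · ext x y
    have h1 := hpsd.1.apply x y
    simp only [map_apply, RCLike.star_def, Complex.conj_ofReal] at h1
    simpa using h1
  · have h1 := hpsd.dotProduct_mulVec_nonneg fun x => (w x : ℂ)
    have h2 : (star fun x => (w x : ℂ)) ⬝ᵥ (((correlator p).map (↑)) *ᵥ fun x => (w x : ℂ)) =
        ((star w ⬝ᵥ (correlator p *ᵥ w) : ℝ) : ℂ) := by
      simp [dotProduct, mulVec]
    rw [h2] at h1
    exact_mod_cast h1

end Densities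

end XORGames

namespace XORGames

open Matrix
open scoped Kronecker

/-! ### The bias as the value of the semidefinite program -/

section Bias

variable {I : Type*} [Fintype I]

/-- The bias of a density is the probability of winning minus that of losing, and on each question
pair this difference is the correlator up to the sign `(-1)^f`. -/
theorem XORGame.two_mul_value_sub_one (G : XORGame I) {p : I → I → ZMod 2 → ZMod 2 → ℝ}
    (hp : p ∈ quantumDensities I (ZMod 2)) :
    2 * G.toGame.value p - 1 = ∑ x, ∑ y, G.costMatrix x y * correlator p x y := by
  have h1 : 2 * G.toGame.value p - 1 = 2 * G.toGame.value p - ∑ x, ∑ y, G.prior x y := by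
    rw [G.prior_sum]
  rw [h1, Game.value]
  simp only [Finset.mul_sum, ← Finset.sum_sub_distrib]
  refine Finset.sum_congr rfl fun x _ => Finset.sum_congr rfl fun y _ => ?_
  have h := sum_eq_one_of_mem_quantumDensities hp x y
  have h01 : ∀ a : ZMod 2, a = 0 ∨ a = 1 := by decide
  simp only [sum_zmod_two] at h ⊢
  rcases h01 (G.f x y) with hf | hf
  · have h11 : (1 : ZMod 2) + 1 = 0 := rfl
    simp [XORGame.toGame, XORGame.costMatrix, correlator, hf, h11]
    linear_combination G.prior x y * h
  · have h11 : (1 : ZMod 2) + 1 ≠ 1 := by decide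
    have hv : (1 : ZMod 2).val = 1 := rfl
    simp [XORGame.toGame, XORGame.costMatrix, correlator, hf, h11, hv]
    linear_combination G.prior x y * h

theorem XORGame.trace_symCostMatrix_mul (G : XORGame I) {X : Matrix I I ℝ}
    (hX : IsCorrelation X) :
    (G.symCostMatrix * X).trace = ∑ x, ∑ y, G.costMatrix x y * X x y := by
  have h1 : (G.costMatrix * X).trace = ∑ x, ∑ y, G.costMatrix x y * X x y := by
    simp only [trace, diag_apply, mul_apply]
    exact Finset.sum_congr rfl fun x _ => Finset.sum_congr rfl fun y _ => by
      rw [hX.apply_symm x y]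
  have h2 : (G.costMatrixᵀ * X).trace = (G.costMatrix * X).trace := by
    have hXT : Xᵀ = X := hX.1.1
    rw [← trace_transpose, transpose_mul, transpose_transpose, hXT, trace_mul_comm]
  rw [XORGame.symCostMatrix, Matrix.smul_mul, Matrix.add_mul, trace_smul, trace_add, h2, h1,
    smul_eq_mul]
  ring

theorem XORGame.isHermitian_symCostMatrix (G : XORGame I) : G.symCostMatrix.IsHermitian := by
  ext x y
  simp only [XORGame.symCostMatrix, conjTranspose_apply, Matrix.smul_apply, Matrix.add_apply,
    transpose_apply, star_trivial, smul_eq_mul]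
  ring

variable [DecidableEq I]

theorem XORGame.syncQuantumBias_eq_of_trace_eq (G : XORGame I) {X : Matrix I I ℝ} {y : I → ℝ}
    (hX : IsCorrelation X) (hy : IsDualFeasible G.symCostMatrix y)
    (h : (G.symCostMatrix * X).trace = ∑ i, y i) : G.toGame.syncQuantumBias = ∑ i, y i := by
  have hval : ∀ p ∈ syncQuantumDensities I (ZMod 2),
      2 * G.toGame.value p - 1 = (G.symCostMatrix * correlator p).trace := fun p hp => by
    rw [G.two_mul_value_sub_one hp.1, G.trace_symCostMatrix_mul (isCorrelation_correlator hp)]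
  obtain ⟨p, hp, rfl⟩ := exists_mem_syncQuantumDensities_correlator_eq hX
  have hg : IsGreatest (G.toGame.value '' syncQuantumDensities I (ZMod 2))
      (G.toGame.value p) := by
    refine ⟨⟨p, hp, rfl⟩, ?_⟩
    rintro _ ⟨q, hq, rfl⟩
    have h1 := trace_mul_le_of_isDualFeasible (isCorrelation_correlator hq) hy
    have h2 := hval p hp
    have h3 := hval q hq
    linarith
  rw [Game.syncQuantumBias, Game.syncQuantumValue, hg.csSup_eq, hval p hp, h]

end Bias

/-! ### Products of games -/

section Xor

namespace XORGame

theorem isSyncXOR_iff {I : Type*} [Fintype I] (G : XORGame I) :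
    G.IsSyncXOR ↔ (∀ x, G.f x x = 0) ∧ (∀ x y, G.f x y = G.f y x) ∧
      ∀ x y, G.prior x y = G.prior y x := by
  have hsync : ∀ c : ZMod 2, (∀ a b : ZMod 2, a ≠ b → decide (a + b = c) = false) ↔ c = 0 := by
    decide
  have hsymm : ∀ c d : ZMod 2,
      (∀ a b : ZMod 2, decide (a + b = c) = decide (b + a = d)) ↔ c = d := by
    decide
  exact and_congr (forall_congr' fun x => hsync _)
    (and_congr_left' (forall_congr' fun x => forall_congr' fun y => hsymm _ _))

theorem IsSyncXOR.symCostMatrix_eq {I : Type*} [Fintype I] {G : XORGame I} (hG : G.IsSyncXOR) :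
    G.symCostMatrix = G.costMatrix := by
  obtain ⟨-, hf, hp⟩ := G.isSyncXOR_iff.mp hG
  ext x y
  simp [symCostMatrix, costMatrix, hf y x, hp y x]
  ring

variable {I J : Type*} [Fintype I] [Fintype J] {G : XORGame I} {H : XORGame J}

theorem IsSyncXOR.xor (hG : G.IsSyncXOR) (hH : H.IsSyncXOR) : (G.xor H).IsSyncXOR := by
  rw [isSyncXOR_iff] at *
  refine ⟨fun x => ?_, fun x y => ?_, fun x y => ?_⟩
  · simp [XORGame.xor, hG.1, hH.1]
  · simp [XORGame.xor, hG.2.1 x.1, hH.2.1 x.2]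
  · simp [XORGame.xor, hG.2.2 x.1, hH.2.2 x.2]

theorem costMatrix_xor (G : XORGame I) (H : XORGame J) :
    (G.xor H).costMatrix = G.costMatrix ⊗ₖ H.costMatrix := by
  ext x y
  simp only [costMatrix, XORGame.xor, of_apply, kroneckerMap_apply, ZMod.val_add,
    ← neg_one_pow_eq_pow_mod_two, pow_add]
  ring

theorem symCostMatrix_xor (hG : G.IsSyncXOR) (hH : H.IsSyncXOR) :
    (G.xor H).symCostMatrix = G.symCostMatrix ⊗ₖ H.symCostMatrix := by
  rw [(hG.xor hH).symCostMatrix_eq, hG.symCostMatrix_eq, hH.symCostMatrix_eq, costMatrix_xor]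

end XORGame

variable {I J : Type*}

theorem IsCorrelation.kronecker [Finite I] [Finite J] {X : Matrix I I ℝ} {Y : Matrix J J ℝ}
    (hX : IsCorrelation X) (hY : IsCorrelation Y) : IsCorrelation (X ⊗ₖ Y) :=
  ⟨hX.1.kronecker hY.1, fun i => by simp [hX.2, hY.2]⟩

/-- Each target is half a sum of two Kronecker products of `D ± A` with `D' ± A'`, the cross terms
cancelling. Both signs are needed in each factor. -/
theorem posSemidef_kronecker_sub_kronecker [Finite I] [Finite J] {D A : Matrix I I ℝ}
    {D' A' : Matrix J J ℝ} (h : (D - A).PosSemidef) (h' : (D + A).PosSemidef)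
    (k : (D' - A').PosSemidef) (k' : (D' + A').PosSemidef) :
    (D ⊗ₖ D' - A ⊗ₖ A').PosSemidef ∧ (D ⊗ₖ D' + A ⊗ₖ A').PosSemidef := by
  have half : (0 : ℝ) ≤ 1 / 2 := by norm_num
  have h1 : D ⊗ₖ D' - A ⊗ₖ A' =
      (1 / 2 : ℝ) • ((D - A) ⊗ₖ (D' + A') + (D + A) ⊗ₖ (D' - A')) := by
    ext i j
    simp
    ring
  have h2 : D ⊗ₖ D' + A ⊗ₖ A' =
      (1 / 2 : ℝ) • ((D - A) ⊗ₖ (D' - A') + (D + A) ⊗ₖ (D' + A')) := by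
    ext i j
    simp
    ring
  rw [h1, h2]
  exact ⟨((h.kronecker k').add (h'.kronecker k)).smul half,
    ((h.kronecker k).add (h'.kronecker k')).smul half⟩

end Xor

end XORGames

theorem mainTheorem7 {I₁ : Type*} {I₂ : Type*} [Fintype I₁] [DecidableEq I₁]
    [Fintype I₂] [DecidableEq I₂] (G₁ : XORGames.XORGame I₁) (G₂ : XORGames.XORGame I₂)
    (h₁ : G₁.IsBalanced) (h₂ : G₂.IsBalanced) :
    (G₁.xor G₂).toGame.syncQuantumBias =
        G₁.toGame.syncQuantumBias * G₂.toGame.syncQuantumBias ∧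
      (G₁.xor G₂).IsBalanced := by
  open XORGames Matrix Kronecker in
  obtain ⟨hs₁, y₁, huniq₁, hle₁, hge₁⟩ := h₁
  obtain ⟨hs₂, y₂, huniq₂, hle₂, hge₂⟩ := h₂
  obtain ⟨X₁, hX₁, htr₁⟩ :=
    ((huniq₁ y₁).mpr rfl).exists_isCorrelation_trace_eq G₁.isHermitian_symCostMatrix
  obtain ⟨X₂, hX₂, htr₂⟩ :=
    ((huniq₂ y₂).mpr rfl).exists_isCorrelation_trace_eq G₂.isHermitian_symCostMatrix
  have hA := XORGame.symCostMatrix_xor hs₁ hs₂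
  have hD : diagonal (fun i : I₁ × I₂ => y₁ i.1 * y₂ i.2) = diagonal y₁ ⊗ₖ diagonal y₂ :=
    (diagonal_kronecker_diagonal y₁ y₂).symm
  rw [sub_neg_eq_add, add_comm] at hge₁ hge₂
  have hpsd := posSemidef_kronecker_sub_kronecker hle₁ hge₁ hle₂ hge₂
  rw [← hA, ← hD] at hpsd
  have hX := hX₁.kronecker hX₂
  have hsum : ∑ i : I₁ × I₂, y₁ i.1 * y₂ i.2 = (∑ i, y₁ i) * ∑ j, y₂ j := by
    rw [Fintype.sum_prod_type, Finset.sum_mul_sum]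
  have htr : ((G₁.xor G₂).symCostMatrix * (X₁ ⊗ₖ X₂)).trace =
      ∑ i : I₁ × I₂, y₁ i.1 * y₂ i.2 := by
    rw [hA, ← mul_kronecker_mul, trace_kronecker, htr₁, htr₂, hsum]
  refine ⟨?_, hs₁.xor hs₂, fun i => y₁ i.1 * y₂ i.2,
    isDualOptimal_iff_eq_of_trace_eq hX hpsd.1 htr, hpsd.1, ?_⟩
  · rw [(G₁.xor G₂).syncQuantumBias_eq_of_trace_eq hX hpsd.1 htr,
      G₁.syncQuantumBias_eq_of_trace_eq hX₁ hle₁ htr₁,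
      G₂.syncQuantumBias_eq_of_trace_eq hX₂ hle₂ htr₂, hsum]
  · rw [sub_neg_eq_add, add_comm]
    exact hpsd.2
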